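/- Let $\mathbb F_q$ be a finite field with $q$ elements, let $K=\mathbb F_q(\theta)$ be the rational function field, and let $K_\infty$ be its completion at the infinite place. Put $\ell_0=1$ and $\ell_d=\prod_{i=1}^d(\theta-\theta^{q^i})$ for $d\ge 1$. For positive integers $s_1,\dots,s_n$ and $\varepsilon_1,\dots,\varepsilon_n\in\mathbb F_q^\times$, the alternating Carlitz multiple polylogarithm (ACMPL) with index $(s_1,\dots,s_n)$ and signs $(\varepsilon_1,\dots,\varepsilon_n)$ is $$\mathrm{Li}\begin{pmatrix}\varepsilon_1&\dots&\varepsilon_n\\ s_1&\dots&s_n\end{pmatrix}=\sum_{d_1>\cdots>d_n\ge 0}\frac{\varepsilon_1^{d_1}\cdots\varepsilon_n^{d_n}}{\ell_{d_1}^{s_1}\cdots\ell_{d_n}^{s_n}}\in K_\infty,$$ and its weight is $s_1+\dots+s_n$. For an integer $w\ge 1$ let $\mathcal{AL}_w\subset K_\infty$ be the $K$-vector space spanned by all ACMPL's of weight $w$, and let $\mathcal{AS}_w$ be the set of those ACMPL's of weight $w$ for which no $s_i$ is divisible by $q$. Define $s(w)$ for $w\ge1$ by $s(w)=(q-1)q^{w-1}$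 if $1\le w<q$, $s(q)=(q-1)(q^{q-1}-1)$, and $s(w)=(q-1)\sum_{i=1}^{q-1}s(w-i)+s(w-q)$ if $w>q$. Theorem. For every integer $w\ge 1$, the set $\mathcal{AS}_w$ spans $\mathcal{AL}_w$ over $K$. In particular, $\dim_K\mathcal{AL}_w\le s(w)$. -/

import Mathlib

open scoped WithZero

noncomputable section

namespace ACMPL

/-- A positive array: a finite sequence of pairs `(ε_i, s_i)` with `ε_i` a nonzero element of the
constant field `F` and `s_i` a positive integer. The empty array (`depth = 0`) is allowed. -/
structure PosArray (F : Type*) [Field F] where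
  depth : ℕ
  sign : Fin depth → Fˣ
  index : Fin depth → ℕ+

/-- The weight `s_1 + ⋯ + s_n`. -/
def PosArray.weight {F : Type*} [Field F] (a : PosArray F) : ℕ :=
  ∑ i, (a.index i : ℕ)

/-- No entry `s_i` of the array is divisible by `q = #F`. -/
def PosArray.NoPartDvd {F : Type*} [Field F] [Fintype F] (a : PosArray F) : Prop :=
  ∀ i, ¬ Fintype.card F ∣ (a.index i : ℕ)

/-- `ℓ_d = ∏_{i=1}^d (θ - θ^(q^i))` in `K = F(θ)`, where `q = #F`; in particular `ℓ_0 = 1`. -/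
def ell (F : Type*) [Field F] [Fintype F] (d : ℕ) : RatFunc F :=
  ∏ i ∈ Finset.Icc 1 d, (RatFunc.X - RatFunc.X ^ (Fintype.card F ^ i))

/-- The summand `∏_i ε_i^(d_i) / ℓ_(d_i)^(s_i)` in `K`. -/
def PosArray.term {F : Type*} [Field F] [Fintype F] (a : PosArray F) (d : Fin a.depth → ℕ) :
    RatFunc F :=
  ∏ i, RatFunc.C (a.sign i : F) ^ d i / ell F (d i) ^ (a.index i : ℕ)

/-- The alternating Carlitz multiple polylogarithm
`∑_{d_1 > ⋯ > d_n ≥ 0} ∏_i ε_i^(d_i) / ℓ_(d_i)^(s_i)` in `K_∞`, the completion of `K = F(θ)` at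
the infinite place. The series converges by `summable_term` below. -/
def Li {F : Type*} [Field F] [Fintype F] [DecidableEq (RatFunc F)] (a : PosArray F) :
    RatFunc.CompletionAtInfty F :=
  ∑' d : {d : Fin a.depth → ℕ // StrictAnti d},
    algebraMap (RatFunc F) (RatFunc.CompletionAtInfty F) (a.term d.1)

/-- The `K`-span in `K_∞` of all alternating Carlitz multiple polylogarithms of weight `w`. -/
def AL (F : Type*) [Field F] [Fintype F] [DecidableEq (RatFunc F)] (w : ℕ) :
    Submodule (RatFunc F) (RatFunc.CompletionAtInfty F) :=
  Submodule.span (RatFunc F) (Li '' {a : PosArray F | a.weight = w})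

/-- The set of alternating Carlitz multiple polylogarithms of weight `w` none of whose indices
`s_i` is divisible by `q = #F`. -/
def AS (F : Type*) [Field F] [Fintype F] [DecidableEq (RatFunc F)] (w : ℕ) :
    Set (RatFunc.CompletionAtInfty F) :=
  Li '' {a : PosArray F | a.weight = w ∧ a.NoPartDvd}

/-- The Fibonacci-like sequence `s(w)`, see `seqS_of_lt`, `seqS_self` and `seqS_of_gt` for its
defining equations; the value at `w = 0` is a convention that these equations do not use. -/
def seqS (q : ℕ) : ℕ → ℕ
  | 0 => 1
  | w + 1 =>
    if w + 1 < q then (q - 1) * q ^ w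
    else if w + 1 = q then (q - 1) * (q ^ w - 1)
    else (q - 1) * ∑ i : Fin (q - 1), seqS q (w - i) + seqS q (w - (q - 1))

theorem seqS_of_lt {q w : ℕ} (h1 : 1 ≤ w) (h2 : w < q) : seqS q w = (q - 1) * q ^ (w - 1) := by
  obtain ⟨w, rfl⟩ := Nat.exists_eq_add_of_le' h1
  simp [seqS, h2]

theorem seqS_self {q : ℕ} (h1 : 1 ≤ q) : seqS q q = (q - 1) * (q ^ (q - 1) - 1) := by
  obtain ⟨w, rfl⟩ := Nat.exists_eq_add_of_le' h1
  simp [seqS]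

theorem seqS_of_gt {q w : ℕ} (h1 : 1 ≤ q) (h2 : q < w) :
    seqS q w = (q - 1) * ∑ i ∈ Finset.Icc 1 (q - 1), seqS q (w - i) + seqS q (w - q) := by
  obtain ⟨w, rfl⟩ := Nat.exists_eq_add_of_le' (h1.trans h2.le)
  rw [seqS, if_neg (by omega), if_neg (by omega), Fin.sum_univ_eq_sum_range (fun i => seqS q (w - i)),
    Finset.range_eq_Ico, Finset.sum_Ico_eq_sum_range, ← Finset.Ico_add_one_right_eq_Icc,
    Finset.sum_Ico_eq_sum_range]
  congr 2
  · refine Finset.sum_congr (by simp) fun i _ => ?_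
    congr 1
    omega
  · omega

section convergence

variable {F : Type*} [Field F] [DecidableEq (RatFunc F)]

/-- The topology of `K_∞` is nonarchimedean. -/
theorem nonarchimedean_completionAtInfty :
    NonarchimedeanRing (RatFunc.CompletionAtInfty F) := by
  have h := (Valued.v : Valuation (RatFunc.CompletionAtInfty F) ℤᵐ⁰).subgroups_basis.nonarchimedean
  have e := Valued.toUniformSpace_eq (RatFunc.CompletionAtInfty F) ℤᵐ⁰
  have e' := congrArg (fun u => @UniformSpace.toTopologicalSpace _ u) e
  change _ = (Valued.v : Valuation (RatFunc.CompletionAtInfty F) ℤᵐ⁰).subgroups_basis.topology at e'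
  rw [← e'] at h
  exact h

theorem valued_algebraMap (x : RatFunc F) :
    Valued.v (algebraMap (RatFunc F) (RatFunc.CompletionAtInfty F) x) =
      RatFunc.inftyValuation F x :=
  letI := RatFunc.inftyValued F
  Valued.valuedCompletion_apply x

variable [Fintype F]

theorem inftyValuation_ell_ge (d : ℕ) :
    WithZero.exp (d : ℤ) ≤ RatFunc.inftyValuation F (ell F d) := by
  have hq : 1 < Fintype.card F := Fintype.one_lt_card
  have key : ∀ i ∈ Finset.Icc 1 d, WithZero.exp (1 : ℤ) ≤
      RatFunc.inftyValuation F (RatFunc.X - RatFunc.X ^ (Fintype.card F ^ i)) := by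
    intro i hi
    have hi1 : 1 ≤ i := (Finset.mem_Icc.mp hi).1
    have hqi : 1 < Fintype.card F ^ i := Nat.one_lt_pow (by omega) hq
    have hlt : RatFunc.inftyValuation F RatFunc.X <
        RatFunc.inftyValuation F (RatFunc.X ^ (Fintype.card F ^ i)) := by
      rw [map_pow, RatFunc.inftyValuation.X, ← WithZero.exp_nsmul, WithZero.exp_lt_exp]
      simpa using (by exact_mod_cast hqi : (1 : ℤ) < (Fintype.card F : ℤ) ^ i)
    rw [Valuation.map_sub_eq_of_lt_right _ hlt]
    exact (RatFunc.inftyValuation.X F).ge.trans hlt.le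
  rw [ell, map_prod]
  calc WithZero.exp (d : ℤ) = ∏ _i ∈ Finset.Icc 1 d, WithZero.exp (1 : ℤ) := by
        simp [← WithZero.exp_nsmul]
    _ ≤ _ := Finset.prod_le_prod' key

theorem inftyValuation_term_le (a : PosArray F) (d : Fin a.depth → ℕ) :
    RatFunc.inftyValuation F (a.term d) ≤ WithZero.exp (-(∑ i, d i : ℕ) : ℤ) := by
  have key : ∀ i, RatFunc.inftyValuation F
      (RatFunc.C (a.sign i : F) ^ d i / ell F (d i) ^ (a.index i : ℕ)) ≤
        WithZero.exp (-(d i : ℤ)) := by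
    intro i
    have h1 := inftyValuation_ell_ge (F := F) (d i)
    have h2 : (1 : ℤᵐ⁰) ≤ WithZero.exp (d i : ℤ) := by
      rw [← WithZero.exp_zero, WithZero.exp_le_exp]; positivity
    rw [map_div₀, map_pow, map_pow, RatFunc.inftyValuation.C F (a.sign i).ne_zero, one_pow,
      one_div, WithZero.exp_neg]
    refine inv_anti₀ (WithZero.exp_pos) (h1.trans ?_)
    exact le_self_pow₀ (h2.trans h1) (a.index i).ne_zero
  rw [PosArray.term, map_prod]
  refine (Finset.prod_le_prod' fun i _ => key i).trans (le_of_eq ?_)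
  rw [Nat.cast_sum, ← Finset.sum_neg_distrib]
  induction (Finset.univ : Finset (Fin a.depth)) using Finset.cons_induction with
  | empty => simp
  | cons i s hi ih => rw [Finset.prod_cons, Finset.sum_cons, WithZero.exp_add, ih]

/-- The series defining `Li` converges in `K_∞`. -/
theorem summable_term (a : PosArray F) :
    Summable fun d : {d : Fin a.depth → ℕ // StrictAnti d} =>
      algebraMap (RatFunc F) (RatFunc.CompletionAtInfty F) (a.term d.1) := by
  have := nonarchimedean_completionAtInfty (F := F)
  have : CompleteSpace (RatFunc.CompletionAtInfty F) :=
    letI := RatFunc.inftyValued F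
    inferInstanceAs (CompleteSpace (UniformSpace.Completion (RatFunc F)))
  refine NonarchimedeanAddGroup.summable_of_tendsto_cofinite_zero ?_
  rw [(Valued.hasBasis_nhds_zero (RatFunc.CompletionAtInfty F) ℤᵐ⁰).tendsto_right_iff]
  intro γ _
  simp only [Valuation.restrict_lt_iff_lt_embedding, Set.mem_ofPred_eq, valued_algebraMap]
  obtain ⟨N, hN⟩ : ∃ N : ℕ, WithZero.exp (-(N : ℤ)) <
      MonoidWithZeroHom.ValueGroup₀.embedding γ.1 := by
    have h0 : MonoidWithZeroHom.ValueGroup₀.embedding γ.1 ≠ 0 := by simp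
    refine ⟨(1 - WithZero.log (MonoidWithZeroHom.ValueGroup₀.embedding γ.1)).toNat, ?_⟩
    rw [← WithZero.lt_log_iff_exp_lt h0]
    omega
  rw [Filter.eventually_cofinite]
  have hfin : Set.Finite {d : Fin a.depth → ℕ | ∀ i, d i ∈ Set.Iic N} :=
    (Set.Finite.pi' fun _ => Set.finite_Iic N)
  refine (hfin.preimage Subtype.val_injective.injOn).subset fun d hd => ?_
  intro i
  by_contra hlt
  apply hd
  refine (inftyValuation_term_le a d.1).trans_lt (lt_of_le_of_lt ?_ hN)
  rw [WithZero.exp_le_exp]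
  have h1 : d.1 i ≤ ∑ j, d.1 j := Finset.single_le_sum (fun _ _ => Nat.zero_le _) (Finset.mem_univ i)
  have h2 : N < d.1 i := by simpa using hlt
  have : (N : ℤ) ≤ ((∑ j, d.1 j : ℕ) : ℤ) := by exact_mod_cast h2.le.trans h1
  omega

end convergence

end ACMPL

end

/-!
The starting point is the identity `∑_{e ≤ d} ℓ_e ^ (1 - q) = ℓ_(d+1) / (ℓ_1 ℓ_d ^ q)`, which
rewrites the summand `ε ^ d / ℓ_d ^ q` as `ε⁻¹ ℓ_1` times
`ε ^ (d+1) / ℓ_(d+1) * ∑_{e < d+1} ℓ_e ^ (1 - q)` (`fac_qPos`). Multiplying by a truncated sum,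
using the stuffle product, summing over `d` and prepending an arbitrary word `p`, one obtains for
every column `(ε, q)` followed by a column `y` and a word `r` a relation

`Li (p (ε, q) y r) + Li (p ((ε, q) + y) r) = ε⁻¹ ℓ_1 * (a sum of Li's of the same weight)`,

where `(ε, q) + y` multiplies signs and adds indices; if nothing follows `(ε, q)`, the left side is
`Li (p (ε, q))` alone (`exists_sum_wordLi_weakCons_eq`).

The factor `ℓ_1 = θ - θ ^ q` vanishes at `θ = 0`. Let `R` be the valuation ring of that place of
`K`, and consider the `R`-lattice spanned by all `Li`'s of a given weight, which is finitely
generated. Modulo the maximal ideal of `R` the relations have only their left sides. An index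
`(k + 1) q` can thus be split, up to sign, into `q` followed by `k q`, and an index `q` either
merges with its right neighbour or, at the end of the word, gives `0`. Working from right to left,
the right neighbour is never divisible by `q`, so merging leaves an index not divisible by `q`, and
all indices divisible by `q` disappear (`wordLi_append_mem`). By Nakayama's lemma, the `Li`'s
without index divisible by `q` generate the whole lattice (`lattice_le_goodLattice`), hence also
its `K`-span.

The bound on the dimension is a count of generators: a word without index divisible by `q` starts
with an index below `q`, or arises from such a word of weight smaller by `q` by adding `q` to its
first index. This is the recursion that defines `seqS` (`exists_finset_good`).
-/

open scoped WithZero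

noncomputable section

namespace ACMPL

/-! ### Words and truncated sums -/

/-- A pair `(ε, s)` of a sign and a positive integer, one column of an array. -/
abbrev Letter (F : Type*) [Field F] := Fˣ × ℕ+

/-- An array, written as the list of its columns. -/
abbrev Word (F : Type*) [Field F] := List (Letter F)

section words

variable {F : Type*} [Field F]

/-- The weight of a word: the sum of its indices. -/
def Word.weight (w : Word F) : ℕ := (w.map fun x => (x.2 : ℕ)).sum

@[simp] theorem Word.weight_nil : Word.weight ([] : Word F) = 0 := rfl

@[simp] theorem Word.weight_cons (x : Letter F) (w : Word F) :
    Word.weight (x :: w) = x.2 + Word.weight w := by simp [Word.weight]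

@[simp] theorem Word.weight_append (v w : Word F) :
    Word.weight (v ++ w) = Word.weight v + Word.weight w := by simp [Word.weight]

/-- The letter by which two letters standing at the same summation index are replaced: signs are
multiplied and indices are added. -/
def Letter.merge (x y : Letter F) : Letter F := (x.1 * y.1, x.2 + y.2)

/-- The words occurring in the stuffle product of the one-letter word `x` with a word. -/
def stuffle (x : Letter F) : Word F → List (Word F)
  | [] => [[x]]
  | y :: r => (x :: y :: r) :: (x.merge y :: r) :: (stuffle x r).map (y :: ·)

theorem weight_of_mem_stuffle (x : Letter F) (r : Word F) :
    ∀ u ∈ stuffle x r, Word.weight u = x.2 + Word.weight r := by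
  induction r with
  | nil => simp [stuffle]
  | cons y r ih =>
    intro u hu
    simp only [stuffle, List.mem_cons, List.mem_map] at hu
    rcases hu with rfl | rfl | ⟨v, hv, rfl⟩
    · simp
    · simp [Letter.merge, add_assoc]
    · simp [ih v hv]; ring

variable [Fintype F]

/-- The summand `ε ^ d / ℓ_d ^ s` attached to the letter `(ε, s)`. -/
def fac (x : Letter F) (d : ℕ) : RatFunc F :=
  RatFunc.C (x.1 : F) ^ d / ell F d ^ (x.2 : ℕ)

theorem fac_merge (x y : Letter F) (d : ℕ) : fac (x.merge y) d = fac x d * fac y d := by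
  simp only [fac, Letter.merge, Units.val_mul, map_mul, PNat.add_coe]
  rw [mul_pow, pow_add, div_mul_div_comm]

/-- The operator on sequences that prepends the letter `x`:
`g ↦ (d ↦ ∑_{e < d} fac x e * g e)`. -/
def letterOp (x : Letter F) : Module.End (RatFunc F) (ℕ → RatFunc F) where
  toFun g d := ∑ e ∈ Finset.range d, fac x e * g e
  map_add' g h := by
    funext d
    simp [mul_add, Finset.sum_add_distrib]
  map_smul' c g := by
    funext d
    simp [Finset.mul_sum, mul_left_comm]

theorem letterOp_apply (x : Letter F) (g : ℕ → RatFunc F) (d : ℕ) :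
    letterOp x g d = ∑ e ∈ Finset.range d, fac x e * g e := rfl

theorem letterOp_succ (x : Letter F) (g : ℕ → RatFunc F) (d : ℕ) :
    letterOp x g (d + 1) = letterOp x g d + fac x d * g d := by
  simp [letterOp_apply, Finset.sum_range_succ]

/-- The operator on sequences that prepends a word. -/
def wordOp (w : Word F) : Module.End (RatFunc F) (ℕ → RatFunc F) := (w.map letterOp).prod

/-- The truncated sum `∑_{d > d_1 > ⋯ > d_n ≥ 0} ∏_i ε_i ^ d_i / ℓ_(d_i) ^ s_i`, as a function
of `d`. -/
def trunc (w : Word F) : ℕ → RatFunc F := wordOp w 1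

@[simp] theorem trunc_nil : trunc ([] : Word F) = 1 := rfl

theorem trunc_append (v w : Word F) : trunc (v ++ w) = wordOp v (trunc w) := by
  simp [trunc, wordOp]

theorem trunc_cons (x : Letter F) (w : Word F) : trunc (x :: w) = letterOp x (trunc w) := by
  simp [trunc, wordOp]

theorem trunc_cons_succ (x : Letter F) (w : Word F) (d : ℕ) :
    trunc (x :: w) (d + 1) = trunc (x :: w) d + fac x d * trunc w d := by
  rw [trunc_cons, letterOp_succ]

theorem trunc_zero {w : Word F} (hw : w ≠ []) : trunc w 0 = 0 := by
  cases w with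
  | nil => exact absurd rfl hw
  | cons x w => simp [trunc_cons, letterOp_apply]

/-- The stuffle product formula with a one-letter word. -/
theorem trunc_mul_eq_sum_stuffle (x : Letter F) (r : Word F) :
    trunc [x] * trunc r = ((stuffle x r).map trunc).sum := by
  induction r with
  | nil => simp [stuffle]
  | cons y r ih =>
    have hmap : (((stuffle x r).map (y :: ·)).map trunc).sum =
        letterOp y (trunc [x] * trunc r) := by
      rw [ih, map_list_sum, List.map_map, List.map_map]
      exact congrArg List.sum (List.map_congr_left fun u _ => trunc_cons y u)
    rw [stuffle, List.map_cons, List.map_cons, List.sum_cons, List.sum_cons, hmap]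
    funext d
    induction d with
    | zero => simp [trunc_cons, letterOp_apply]
    | succ d ihd =>
      simp only [Pi.mul_apply, Pi.add_apply] at ihd ⊢
      rw [trunc_cons_succ x [], trunc_cons_succ y r, trunc_cons_succ x (y :: r),
        trunc_cons_succ (x.merge y) r, letterOp_succ, fac_merge]
      simp only [Pi.mul_apply, trunc_nil, Pi.one_apply]
      linear_combination ihd

theorem sum_trunc_append (p : Word F) (l : List (Word F)) :
    (l.map fun v => trunc (p ++ v)).sum = wordOp p (l.map trunc).sum := by
  rw [map_list_sum, List.map_map]
  exact congrArg List.sum (List.map_congr_left fun v _ => trunc_append p v)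

/-! ### The fundamental relation -/

/-- The cardinality `q` of the constant field, as a positive integer. -/
def qPos (F : Type*) [Field F] [Fintype F] : ℕ+ := ⟨Fintype.card F, Fintype.card_pos⟩

/-- `q - 1` as a positive integer. -/
def qPred (F : Type*) [Field F] [Fintype F] : ℕ+ :=
  ⟨Fintype.card F - 1, Nat.sub_pos_of_lt Fintype.one_lt_card⟩

@[simp] theorem qPos_coe : (qPos F : ℕ) = Fintype.card F := rfl

@[simp] theorem qPred_coe : (qPred F : ℕ) = Fintype.card F - 1 := rfl

theorem ell_zero : ell F 0 = 1 := by simp [ell]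

theorem ell_succ (d : ℕ) :
    ell F (d + 1) = ell F d * (RatFunc.X - RatFunc.X ^ (Fintype.card F ^ (d + 1))) := by
  rw [ell, Finset.prod_Icc_succ_top (by omega), ell]

theorem ell_one : ell F 1 = RatFunc.X - RatFunc.X ^ Fintype.card F := by simp [ell]

theorem ell_ne_zero [DecidableEq (RatFunc F)] (d : ℕ) : ell F d ≠ 0 := by
  intro h
  have := inftyValuation_ell_ge (F := F) d
  rw [h, map_zero, le_zero_iff] at this
  exact WithZero.exp_ne_zero this

/-- The recursion behind `trunc_qPred_succ`; it rests on
`(θ - θ ^ q ^ (d + 1)) ^ q = θ ^ q - θ ^ q ^ (d + 2)`. -/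
theorem ell_succ_succ_mul (d : ℕ) :
    ell F (d + 2) * ell F d ^ Fintype.card F =
      ell F (d + 1) * (ell F (d + 1) ^ Fintype.card F + ell F 1 * ell F d ^ Fintype.card F) := by
  obtain ⟨p, _⟩ := CharP.exists F
  have : CharP (RatFunc F) p := charP_of_injective_algebraMap (algebraMap F (RatFunc F)).injective p
  obtain ⟨n, hp, hn⟩ := FiniteField.card F p
  have : Fact p.Prime := ⟨hp⟩
  rw [ell_succ (d + 1), ell_succ d, mul_pow, ell_one]
  have hfrob : (RatFunc.X - RatFunc.X ^ (Fintype.card F ^ (d + 1)) : RatFunc F) ^ Fintype.card F =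
      RatFunc.X ^ Fintype.card F - RatFunc.X ^ (Fintype.card F ^ (d + 2)) := by
    rw [hn, sub_pow_char_pow, ← hn, ← pow_mul, ← pow_succ]
  rw [hfrob]
  ring

/-- The identity `∑_{e ≤ d} ℓ_e ^ (1 - q) = ℓ_(d+1) / (ℓ_1 ℓ_d ^ q)`. -/
theorem trunc_qPred_succ [DecidableEq (RatFunc F)] (d : ℕ) :
    ell F 1 * ell F d ^ Fintype.card F * trunc [((1 : Fˣ), qPred F)] (d + 1) = ell F (d + 1) := by
  have hq : Fintype.card F - 1 + 1 = Fintype.card F :=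
    Nat.sub_add_cancel Fintype.card_pos
  induction d with
  | zero => simp [trunc_cons, letterOp_apply, fac, ell_zero]
  | succ d ih =>
    have h0 := ell_ne_zero (F := F) d
    have h1 := ell_ne_zero (F := F) (d + 1)
    rw [trunc_cons_succ, mul_add]
    have h2 : ell F (d + 1) ^ Fintype.card F * fac ((1 : Fˣ), qPred F) (d + 1) =
        ell F (d + 1) := by
      simp only [fac, Units.val_one, map_one, one_pow, qPred_coe]
      conv_lhs => rw [← hq, pow_succ]
      rw [hq]
      field_simp
    refine mul_right_cancel₀ (pow_ne_zero (Fintype.card F) h0) ?_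
    simp only [trunc_nil, Pi.one_apply]
    rw [ell_succ_succ_mul]
    linear_combination ell F (d + 1) ^ Fintype.card F * ih +
      ell F 1 * ell F d ^ Fintype.card F * h2

/-- The coefficient `ε⁻¹ ℓ_1` of the fundamental relation. -/
def relCoeff (ε : Fˣ) : RatFunc F := RatFunc.C ((ε⁻¹ : Fˣ) : F) * ell F 1

/-- The fundamental relation between a summand of index `q` at `d` and a truncated sum of index
`(1, q - 1)` with leading summation index `d + 1`. -/
theorem fac_qPos [DecidableEq (RatFunc F)] (ε : Fˣ) (d : ℕ) :
    fac (ε, qPos F) d =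
      relCoeff ε * (fac (ε, 1) (d + 1) * trunc [((1 : Fˣ), qPred F)] (d + 1)) := by
  have h0 := ell_ne_zero (F := F) d
  have h1 := ell_ne_zero (F := F) (d + 1)
  have h := trunc_qPred_succ (F := F) d
  have hε : RatFunc.C ((ε⁻¹ : Fˣ) : F) * RatFunc.C (ε : F) = 1 := by
    rw [← map_mul, Units.inv_mul, map_one]
  simp only [fac, relCoeff, qPos_coe, PNat.one_coe, pow_one]
  rw [div_eq_iff (pow_ne_zero _ h0)]
  have e : RatFunc.C ((ε⁻¹ : Fˣ) : F) * ell F 1 *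
      (RatFunc.C (ε : F) ^ (d + 1) / ell F (d + 1) * trunc [((1 : Fˣ), qPred F)] (d + 1)) *
      ell F d ^ Fintype.card F =
      (RatFunc.C ((ε⁻¹ : Fˣ) : F) * RatFunc.C (ε : F)) * RatFunc.C (ε : F) ^ d *
       ((ell F 1 * ell F d ^ Fintype.card F * trunc [((1 : Fˣ), qPred F)] (d + 1)) /
          ell F (d + 1)) := by
    rw [pow_succ]; ring
  rw [e, h, hε, div_self h1]
  ring

/-- The words that arise from the word `x r` when the index of `x` is allowed to coincide with
the next one. -/
def weakCons (x : Letter F) : Word F → List (Word F)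
  | [] => [[x]]
  | y :: r => [x :: y :: r, x.merge y :: r]

theorem sum_trunc_weakCons (x : Letter F) (r : Word F) :
    ((weakCons x r).map trunc).sum = letterOp x (fun d => trunc r (d + 1)) := by
  cases r with
  | nil =>
    simp only [weakCons, List.map_cons, List.map_nil, List.sum_cons, List.sum_nil, add_zero,
      trunc_cons, trunc_nil, Pi.one_apply]
    rfl
  | cons y r =>
    simp only [weakCons, List.map_cons, List.map_nil, List.sum_cons, List.sum_nil, add_zero]
    funext d
    simp only [trunc_cons x, trunc_cons (x.merge y), Pi.add_apply, letterOp_apply,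
      ← Finset.sum_add_distrib, trunc_cons_succ, fac_merge]
    exact Finset.sum_congr rfl fun e _ => by ring

/-- The fundamental relation, multiplied by `trunc r` and summed. -/
theorem sum_trunc_weakCons_qPos [DecidableEq (RatFunc F)] (ε : Fˣ) (r : Word F) :
    ((weakCons (ε, qPos F) r).map trunc).sum = relCoeff ε •
      ((stuffle ((1 : Fˣ), qPred F) r).map
        fun u d => trunc (((ε, 1) : Letter F) :: u) (d + 1)).sum := by
  rw [sum_trunc_weakCons]
  have hs := trunc_mul_eq_sum_stuffle ((1 : Fˣ), qPred F) r
  have key : ∀ d, ((stuffle ((1 : Fˣ), qPred F) r).map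
        fun u => trunc (((ε, 1) : Letter F) :: u) d).sum =
      letterOp (ε, 1) (trunc [((1 : Fˣ), qPred F)] * trunc r) d := by
    intro d
    rw [hs, map_list_sum, List.map_map, Pi.list_sum_apply, List.map_map]
    exact congrArg List.sum (List.map_congr_left fun u _ => congrFun (trunc_cons _ u) d)
  funext d
  rw [Pi.smul_apply, smul_eq_mul, Pi.list_sum_apply, List.map_map]
  simp only [Function.comp_def, key]
  -- the summand at `0` on the right vanishes because `trunc` of a nonempty word does
  rw [letterOp_apply, letterOp_apply, Finset.sum_range_succ', Pi.mul_apply,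
    trunc_zero (List.cons_ne_nil _ _), zero_mul, mul_zero, add_zero, Finset.mul_sum]
  refine Finset.sum_congr rfl fun e _ => ?_
  rw [fac_qPos, Pi.mul_apply]
  ring

end words

/-! ### Polylogarithms as limits of truncated sums -/

section limits

open Filter Topology

variable {F : Type*} [Field F]

/-- The word of an array. -/
def PosArray.toWord (a : PosArray F) : Word F := List.ofFn fun i => (a.sign i, a.index i)

/-- The array of a word. -/
def Word.toArray (w : Word F) : PosArray F where
  depth := w.length
  sign i := (w.get i).1
  index i := (w.get i).2

theorem Word.toWord_toArray (w : Word F) : PosArray.toWord (Word.toArray w) = w :=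
  List.ofFn_get w

theorem PosArray.weight_toWord (a : PosArray F) : Word.weight a.toWord = a.weight := by
  simp [Word.weight, PosArray.toWord, PosArray.weight, List.map_ofFn, List.sum_ofFn]

open Classical in
/-- The strictly decreasing `n`-tuples of natural numbers below `N`. -/
def decreasing (n N : ℕ) : Finset (Fin n → ℕ) :=
  (Fintype.piFinset fun _ => Finset.range N).filter StrictAnti

theorem mem_decreasing {n N : ℕ} {d : Fin n → ℕ} :
    d ∈ decreasing n N ↔ (∀ i, d i < N) ∧ StrictAnti d := by
  simp [decreasing]

theorem cons_mem_decreasing {n N e : ℕ} {d : Fin n → ℕ} :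
    (Fin.cons e d : Fin (n + 1) → ℕ) ∈ decreasing (n + 1) N ↔ e < N ∧ d ∈ decreasing n e := by
  simp only [mem_decreasing, Fin.forall_fin_succ, Fin.cons_zero, Fin.cons_succ]
  constructor
  · rintro ⟨⟨h1, -⟩, h⟩
    refine ⟨h1, fun i => ?_, fun i j hij => ?_⟩
    · simpa using h (Fin.succ_pos i)
    · simpa using h (Fin.succ_lt_succ_iff.mpr hij)
  · rintro ⟨h1, h2, h⟩
    refine ⟨⟨h1, fun i => (h2 i).trans h1⟩, fun i j hij => ?_⟩
    cases j using Fin.cases with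
    | zero => exact absurd hij (Fin.not_lt_zero _)
    | succ j =>
      cases i using Fin.cases with
      | zero => simpa using h2 j
      | succ i => simpa using h (Fin.succ_lt_succ_iff.mp hij)

variable [Fintype F]

theorem sum_decreasing_eq_trunc {n : ℕ} (x : Fin n → Letter F) (N : ℕ) :
    ∑ d ∈ decreasing n N, ∏ i, fac (x i) (d i) = trunc (List.ofFn x) N := by
  induction n generalizing N with
  | zero =>
    have : decreasing 0 N = {Fin.elim0} := by
      ext d
      simp only [mem_decreasing, Finset.mem_singleton]
      exact ⟨fun _ => Subsingleton.elim _ _, fun _ => ⟨fun i => i.elim0, fun i => i.elim0⟩⟩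
    simp [this]
  | succ n ih =>
    rw [List.ofFn_succ, trunc_cons, letterOp_apply]
    simp_rw [← ih, Finset.mul_sum]
    rw [Finset.sum_sigma']
    refine Finset.sum_bij' (fun d _ => ⟨d 0, Fin.tail d⟩) (fun p _ => Fin.cons p.1 p.2)
      (fun d hd => ?_) (fun p hp => ?_) (fun d _ => Fin.cons_self_tail d)
      (fun p _ => by simp) (fun d _ => ?_)
    · rw [← Fin.cons_self_tail d, cons_mem_decreasing] at hd
      simpa using hd
    · rw [cons_mem_decreasing]
      simpa using hp
    · rw [Fin.prod_univ_succ]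
      rfl

variable [DecidableEq (RatFunc F)]

theorem tendsto_trunc_toWord (a : PosArray F) :
    Tendsto (fun N => algebraMap (RatFunc F) (RatFunc.CompletionAtInfty F) (trunc a.toWord N))
      atTop (𝓝 (Li a)) := by
  classical
  have h := (summable_term a).hasSum
  have hmono : Monotone fun N => (decreasing a.depth N).subtype StrictAnti := by
    intro M N hMN d
    simp only [Finset.mem_subtype, mem_decreasing]
    exact fun hd => ⟨fun i => (hd.1 i).trans_le hMN, hd.2⟩
  have hlim : Tendsto (fun N => (decreasing a.depth N).subtype StrictAnti) atTop atTop := by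
    refine tendsto_atTop_finset_of_monotone hmono fun d => ⟨(∑ i, d.1 i) + 1, ?_⟩
    simp only [Finset.mem_subtype, mem_decreasing]
    exact ⟨fun i => Nat.lt_succ_of_le
      (Finset.single_le_sum (f := d.1) (fun _ _ => Nat.zero_le _) (Finset.mem_univ i)), d.2⟩
  refine (h.comp hlim).congr fun N => ?_
  rw [PosArray.toWord, ← sum_decreasing_eq_trunc, map_sum]
  rw [Function.comp_apply, ← Finset.sum_subtype_of_mem
    (f := fun d => algebraMap (RatFunc F) (RatFunc.CompletionAtInfty F)
      (∏ i, fac (a.sign i, a.index i) (d i))) fun d hd => (mem_decreasing.mp hd).2]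
  rfl

/-- The polylogarithm of a word. -/
def wordLi (w : Word F) : RatFunc.CompletionAtInfty F := Li (Word.toArray w)

theorem tendsto_trunc (w : Word F) :
    Tendsto (fun N => algebraMap (RatFunc F) (RatFunc.CompletionAtInfty F) (trunc w N))
      atTop (𝓝 (wordLi w)) := by
  have h := tendsto_trunc_toWord (Word.toArray w)
  rwa [Word.toWord_toArray] at h

theorem wordLi_toWord (a : PosArray F) : wordLi a.toWord = Li a :=
  tendsto_nhds_unique (tendsto_trunc _) (tendsto_trunc_toWord a)

/-- Every linear relation between truncated sums passes to the limit, even if the truncation bound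
is shifted by `k` on one side. -/
theorem sum_wordLi_eq_of_trunc {v u : List (Word F)} {c : RatFunc F} {k : ℕ}
    (h : ∀ N, (v.map fun w => trunc w N).sum = c * (u.map fun w => trunc w (N + k)).sum) :
    (v.map wordLi).sum = c • (u.map wordLi).sum := by
  have hv := tendsto_list_sum v fun w _ => tendsto_trunc w
  have hu := tendsto_list_sum u fun w _ => (tendsto_add_atTop_iff_nat k).mpr (tendsto_trunc w)
  rw [Algebra.smul_def]
  refine tendsto_nhds_unique hv ((hu.const_mul _).congr fun N => ?_)
  have := congrArg (algebraMap (RatFunc F) (RatFunc.CompletionAtInfty F)) (h N)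
  simpa [map_list_sum, Function.comp_def] using this.symm

/-- For every word `p` and letter `(ε, q)` followed by a word `r`, the polylogarithms of the words
`p x` with `x` in `weakCons (ε, q) r` add up to `ε⁻¹ ℓ_1` times a sum of polylogarithms of words of
the same weight. -/
theorem exists_sum_wordLi_weakCons_eq (p : Word F) (ε : Fˣ) (r : Word F) :
    ∃ us : List (Word F),
      (∀ u ∈ us, Word.weight u = Word.weight p + Fintype.card F + Word.weight r) ∧
      ((weakCons (ε, qPos F) r).map fun v => wordLi (p ++ v)).sum =
        relCoeff ε • (us.map wordLi).sum := by
  have hrel := sum_trunc_weakCons_qPos ε r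
  have hq : Fintype.card F - 1 + 1 = Fintype.card F := Nat.sub_add_cancel Fintype.card_pos
  set st := stuffle ((1 : Fˣ), qPred F) r
  have hw : ∀ u ∈ st, 1 + Word.weight u = Fintype.card F + Word.weight r := by
    intro u hu
    rw [weight_of_mem_stuffle _ _ u hu, qPred_coe]
    omega
  rcases List.eq_nil_or_concat p with rfl | ⟨p, y, rfl⟩
  · refine ⟨st.map (((ε, 1) : Letter F) :: ·), ?_, ?_⟩
    · simp only [List.mem_map]
      rintro _ ⟨u, hu, rfl⟩
      simpa using hw u hu
    · refine sum_wordLi_eq_of_trunc (k := 1) fun N => ?_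
      have := congrFun hrel N
      simpa [Pi.list_sum_apply, Function.comp_def] using this
  · -- moving `y` in front of the sequence `d ↦ trunc u (d + 1)` gives `weakCons y u`
    refine ⟨(st.map fun u => (weakCons y (((ε, 1) : Letter F) :: u)).map (p ++ ·)).flatten,
      ?_, ?_⟩
    · simp only [weakCons, List.mem_flatten, List.mem_map]
      rintro v ⟨_, ⟨u, hu, rfl⟩, hv⟩
      have := hw u hu
      simp only [List.map_cons, List.map_nil, List.mem_cons, List.not_mem_nil, or_false] at hv
      rcases hv with rfl | rfl
      all_goals
        simp [Letter.merge]
        omega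
    · have hfun : ((weakCons (ε, qPos F) r).map fun v => trunc (p.concat y ++ v)).sum =
          relCoeff ε • (((st.map fun u =>
            (weakCons y (((ε, 1) : Letter F) :: u)).map (p ++ ·)).flatten).map trunc).sum := by
        rw [sum_trunc_append, hrel, map_smul, map_list_sum, List.map_map, List.map_flatten,
          List.sum_flatten, List.map_map, List.map_map]
        refine congrArg (relCoeff ε • List.sum ·) (List.map_congr_left fun u _ => ?_)
        simp only [Function.comp_apply, List.map_map]
        refine Eq.trans ?_ (sum_trunc_append p _).symm
        rw [sum_trunc_weakCons]
        simp [wordOp]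
      have := sum_wordLi_eq_of_trunc (k := 0)
        (v := (weakCons (ε, qPos F) r).map fun v => p.concat y ++ v)
        (u := (st.map fun u => (weakCons y (((ε, 1) : Letter F) :: u)).map (p ++ ·)).flatten)
        (c := relCoeff ε) fun N => by
          have := congrFun hfun N
          rw [Pi.smul_apply, Pi.list_sum_apply, Pi.list_sum_apply, List.map_map,
            List.map_map] at this
          rw [List.map_map]
          exact this
      rwa [List.map_map] at this

end limits

/-! ### Elimination of the indices divisible by `q` -/

section elimination

variable {F : Type*} [Field F]

/-- There are only finitely many words of a given weight over a finite field. -/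
theorem finite_setOf_weight_eq [Finite F] (n : ℕ) : {w : Word F | Word.weight w = n}.Finite := by
  induction n using Nat.strong_induction_on with
  | _ n ih =>
    have hfin : (({[]} : Set (Word F)) ∪ ⋃ ε : Fˣ, ⋃ s : {s : ℕ+ // (s : ℕ) ≤ n},
        List.cons (ε, s.1) '' {w : Word F | Word.weight w = n - s.1}).Finite := by
      have : Finite {s : ℕ+ // (s : ℕ) ≤ n} :=
        Finite.of_injective (fun s => (⟨s.1, Nat.lt_succ_of_le s.2⟩ : Fin (n + 1))) fun s t h => by
          simpa [Subtype.ext_iff] using h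
      refine (Set.finite_singleton _).union
        (Set.finite_iUnion fun ε => Set.finite_iUnion fun s => ?_)
      have h1 := s.1.pos
      have h2 := s.2
      exact (ih _ (by omega)).image _
    refine hfin.subset fun w hw => ?_
    cases w with
    | nil => exact Or.inl rfl
    | cons x w =>
      have hw' : (x.2 : ℕ) + Word.weight w = n := by simpa using hw
      refine Or.inr (Set.mem_iUnion.mpr ⟨x.1, Set.mem_iUnion.mpr ⟨⟨x.2, by omega⟩, w, ?_, rfl⟩⟩)
      change Word.weight w = n - (x.2 : ℕ)
      omega

/-- The valuation ring of the place `θ = 0` of `F(θ)`. -/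
def thetaRing (F : Type*) [Field F] : ValuationSubring (RatFunc F) :=
  ((Polynomial.idealX F).valuation (RatFunc F)).valuationSubring

theorem mem_maximalIdeal_of_valuation_lt_one {x : RatFunc F}
    (hx : (Polynomial.idealX F).valuation (RatFunc F) x < 1) :
    ∃ y ∈ IsLocalRing.maximalIdeal (thetaRing F), (y : RatFunc F) = x := by
  refine ⟨⟨x, hx.le⟩, ?_, rfl⟩
  rw [IsLocalRing.mem_maximalIdeal, mem_nonunits_iff]
  intro hu
  obtain ⟨b, hb⟩ := hu.exists_right_inv
  have h1 : x * (b : RatFunc F) = 1 := congrArg Subtype.val hb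
  have h2 : (Polynomial.idealX F).valuation (RatFunc F) (b : RatFunc F) ≤ 1 := b.2
  have h3 := congrArg ((Polynomial.idealX F).valuation (RatFunc F)) h1
  rw [map_mul, map_one] at h3
  exact (mul_lt_one_of_nonneg_of_lt_one_left zero_le hx h2).ne h3

variable [Fintype F]

/-- No index of the word is divisible by `q`. -/
def Word.Good (w : Word F) : Prop := ∀ x ∈ w, ¬ Fintype.card F ∣ (x.2 : ℕ)

theorem Word.good_cons {x : Letter F} {w : Word F} :
    Word.Good (x :: w) ↔ ¬ Fintype.card F ∣ (x.2 : ℕ) ∧ Word.Good w := by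
  simp [Word.Good]

theorem PosArray.good_toWord {a : PosArray F} : Word.Good a.toWord ↔ a.NoPartDvd := by
  simp [Word.Good, PosArray.toWord, PosArray.NoPartDvd, List.mem_ofFn]

/-- The coefficient `ε⁻¹ ℓ_1 = ε⁻¹ (θ - θ ^ q)` vanishes at `θ = 0`. -/
theorem valuation_relCoeff_lt_one (ε : Fˣ) :
    (Polynomial.idealX F).valuation (RatFunc F) (relCoeff ε) < 1 := by
  have hX : (Polynomial.idealX F).valuation (RatFunc F) RatFunc.X < 1 := by
    rw [Polynomial.valuation_X_eq_neg_one, ← WithZero.exp_zero, WithZero.exp_lt_exp]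
    norm_num
  have hC : (Polynomial.idealX F).valuation (RatFunc F) (RatFunc.C ((ε⁻¹ : Fˣ) : F)) ≤ 1 := by
    rw [← RatFunc.algebraMap_C]
    exact (Polynomial.idealX F).valuation_le_one _
  rw [relCoeff, ell_one, map_mul]
  refine mul_lt_one_of_nonneg_of_lt_one_right hC zero_le (Valuation.map_sub_lt _ hX ?_)
  rw [map_pow]
  exact pow_lt_one₀ zero_le hX Fintype.card_ne_zero

variable [DecidableEq (RatFunc F)]

/-- The span over `thetaRing F` of the polylogarithms of all words of weight `n`. -/
def lattice (F : Type*) [Field F] [Fintype F] [DecidableEq (RatFunc F)] (n : ℕ) :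
    Submodule (thetaRing F) (RatFunc.CompletionAtInfty F) :=
  Submodule.span _ (wordLi '' {w : Word F | Word.weight w = n})

/-- The span over `thetaRing F` of the polylogarithms of the words of weight `n` without index
divisible by `q`. -/
def goodLattice (F : Type*) [Field F] [Fintype F] [DecidableEq (RatFunc F)] (n : ℕ) :
    Submodule (thetaRing F) (RatFunc.CompletionAtInfty F) :=
  Submodule.span _ (wordLi '' {w : Word F | Word.weight w = n ∧ Word.Good w})

/-- The fundamental relation, reduced modulo the maximal ideal of `thetaRing F`. -/
theorem sum_wordLi_weakCons_mem (p : Word F) (ε : Fˣ) (r : Word F) :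
    ((weakCons (ε, qPos F) r).map fun v => wordLi (p ++ v)).sum ∈
      IsLocalRing.maximalIdeal (thetaRing F) •
        lattice F (Word.weight p + Fintype.card F + Word.weight r) := by
  obtain ⟨us, hus, h⟩ := exists_sum_wordLi_weakCons_eq p ε r
  obtain ⟨c, hc, hcε⟩ := mem_maximalIdeal_of_valuation_lt_one (valuation_relCoeff_lt_one ε)
  rw [h, ← hcε]
  refine Submodule.smul_mem_smul hc (list_sum_mem ?_)
  intro x hx
  obtain ⟨u, hu, rfl⟩ := List.mem_map.mp hx
  exact Submodule.subset_span ⟨u, hus u hu, rfl⟩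

/-- Modulo the maximal ideal, an index `q` followed by a good word can be eliminated without
changing what precedes it: if it is the last index, the polylogarithm vanishes, and otherwise the
index is merged with its good right neighbour. -/
theorem wordLi_append_qPos_cons_mem {n : ℕ} (p : Word F)
    (hp : ∀ r, Word.Good r → Word.weight (p ++ r) = n → wordLi (p ++ r) ∈
      goodLattice F n ⊔ IsLocalRing.maximalIdeal (thetaRing F) • lattice F n)
    (ε : Fˣ) (r : Word F) (hr : Word.Good r) (hn : Word.weight (p ++ (ε, qPos F) :: r) = n) :
    wordLi (p ++ (ε, qPos F) :: r) ∈
      goodLattice F n ⊔ IsLocalRing.maximalIdeal (thetaRing F) • lattice F n := by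
  have h := sum_wordLi_weakCons_mem p ε r
  have hn' : Word.weight p + Fintype.card F + Word.weight r = n := by
    rw [← hn]; simp [add_assoc]
  rw [hn'] at h
  have h' := Submodule.mem_sup_right (S := goodLattice F n) h
  cases r with
  | nil => simpa [weakCons] using h'
  | cons y r =>
    simp only [weakCons, List.map_cons, List.map_nil, List.sum_cons, List.sum_nil,
      add_zero] at h'
    refine (Submodule.add_mem_iff_left _ (hp _ ?_ ?_)).mp h'
    · rw [Word.good_cons] at hr ⊢
      simpa [Letter.merge, Nat.dvd_add_right] using hr
    · rw [← hn]; simp [Letter.merge, add_assoc]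

/-- The same for an index `(k + 1) q`, which is split into `q` and `k q` for `k > 0`. -/
theorem wordLi_append_cons_mem {n : ℕ} (k : ℕ) (p : Word F)
    (hp : ∀ r, Word.Good r → Word.weight (p ++ r) = n → wordLi (p ++ r) ∈
      goodLattice F n ⊔ IsLocalRing.maximalIdeal (thetaRing F) • lattice F n)
    (x : Letter F) (hx : (x.2 : ℕ) = (k + 1) * Fintype.card F)
    (r : Word F) (hr : Word.Good r) (hn : Word.weight (p ++ x :: r) = n) :
    wordLi (p ++ x :: r) ∈
      goodLattice F n ⊔ IsLocalRing.maximalIdeal (thetaRing F) • lattice F n := by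
  induction k generalizing p x r with
  | zero =>
    obtain ⟨ε, s⟩ := x
    obtain rfl : s = qPos F := PNat.eq (by simpa using hx)
    exact wordLi_append_qPos_cons_mem p hp ε r hr hn
  | succ k ih =>
    have hq := Fintype.card_pos (α := F)
    have hpos : 0 < (k + 1) * Fintype.card F := by positivity
    let y : Letter F := (1, ⟨(k + 1) * Fintype.card F, hpos⟩)
    have hxy : Letter.merge (x.1, qPos F) y = x := by
      refine Prod.ext (mul_one _) (PNat.eq ?_)
      change Fintype.card F + (k + 1) * Fintype.card F = (x.2 : ℕ)
      rw [hx]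
      ring
    have h := sum_wordLi_weakCons_mem p x.1 (y :: r)
    have hn' : Word.weight p + Fintype.card F + Word.weight (y :: r) = n := by
      rw [← hn]
      simp only [Word.weight_cons, Word.weight_append, hx, y, PNat.mk_coe]
      ring
    rw [hn'] at h
    have h' := Submodule.mem_sup_right (S := goodLattice F n) h
    simp only [weakCons, List.map_cons, List.map_nil, List.sum_cons, List.sum_nil,
        add_zero, hxy] at h'
    refine (Submodule.add_mem_iff_right _ ?_).mp h'
    have hsplit : ∀ r : Word F, p ++ (x.1, qPos F) :: r = (p ++ [(x.1, qPos F)]) ++ r := by simp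
    rw [hsplit]
    refine ih (p ++ [(x.1, qPos F)]) (fun r' hr' hw' => ?_) y rfl r hr ?_
    · rw [← hsplit] at hw' ⊢
      exact wordLi_append_qPos_cons_mem p hp x.1 r' hr' hw'
    · rw [← hn']
      simp [add_assoc]

/-- Modulo the maximal ideal every polylogarithm is a combination of good ones: the letters of `p`
are processed from right to left. -/
theorem wordLi_append_mem {n : ℕ} (p r : Word F) (hr : Word.Good r)
    (hn : Word.weight (p ++ r) = n) :
    wordLi (p ++ r) ∈
      goodLattice F n ⊔ IsLocalRing.maximalIdeal (thetaRing F) • lattice F n := by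
  induction p using List.reverseRecOn generalizing r with
  | nil => exact Submodule.mem_sup_left (Submodule.subset_span ⟨r, ⟨hn, hr⟩, rfl⟩)
  | append_singleton p x ih =>
    rw [List.append_assoc, List.singleton_append] at hn ⊢
    by_cases hx : Fintype.card F ∣ (x.2 : ℕ)
    · obtain ⟨k, hk⟩ := hx
      have hk0 : k ≠ 0 := by
        rintro rfl
        exact x.2.ne_zero (by rw [hk, mul_zero])
      obtain ⟨k, rfl⟩ := Nat.exists_eq_succ_of_ne_zero hk0
      exact wordLi_append_cons_mem k p ih x (by rw [hk, mul_comm]) r hr hn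
    · exact ih (x :: r) (Word.good_cons.mpr ⟨hx, hr⟩) hn

/-- Nakayama's lemma lifts the reduction modulo the maximal ideal to an inclusion of lattices. -/
theorem lattice_le_goodLattice (n : ℕ) : lattice F n ≤ goodLattice F n := by
  refine Submodule.le_of_le_smul_of_le_jacobson_bot
    (I := IsLocalRing.maximalIdeal (thetaRing F)) ?_ ?_ ?_
  · exact Submodule.fg_span ((finite_setOf_weight_eq n).image _)
  · rw [IsLocalRing.jacobson_eq_maximalIdeal _ bot_ne_top]
  · refine Submodule.span_le.mpr ?_
    rintro _ ⟨w, hw, rfl⟩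
    have h := wordLi_append_mem (n := n) w [] (by simp [Word.Good]) (by simpa using hw)
    rwa [List.append_nil] at h

theorem AS_eq_image_wordLi (n : ℕ) :
    AS F n = wordLi '' {w : Word F | Word.weight w = n ∧ Word.Good w} := by
  ext x
  constructor
  · rintro ⟨a, ⟨h1, h2⟩, rfl⟩
    exact ⟨a.toWord, ⟨(PosArray.weight_toWord a).trans h1, PosArray.good_toWord.mpr h2⟩,
      wordLi_toWord a⟩
  · rintro ⟨w, ⟨h1, h2⟩, rfl⟩
    refine ⟨Word.toArray w, ⟨?_, ?_⟩, rfl⟩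
    · rw [← PosArray.weight_toWord, Word.toWord_toArray, h1]
    · rwa [← PosArray.good_toWord, Word.toWord_toArray]

theorem span_AS_eq_AL (n : ℕ) : Submodule.span (RatFunc F) (AS F n) = AL F n := by
  refine le_antisymm (Submodule.span_mono (Set.image_mono fun a ha => ha.1)) ?_
  rw [AL, Submodule.span_le]
  rintro _ ⟨a, ha, rfl⟩
  have h : Li a ∈ goodLattice F n := lattice_le_goodLattice n
    (Submodule.subset_span ⟨a.toWord, (PosArray.weight_toWord a).trans ha, wordLi_toWord a⟩)
  rw [goodLattice, ← AS_eq_image_wordLi] at h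
  exact Submodule.span_le_restrictScalars (thetaRing F) (RatFunc F) (AS F n) h

end elimination

/-! ### Counting the words without index divisible by `q` -/

section counting

/-- For `1 ≤ n ≤ q` the number `seqS q n` obeys a recursion of the same shape as for `n > q`, with
the convention `seqS q 0 = 1`. -/
theorem seqS_recursion_of_le {q n : ℕ} (hq : 2 ≤ q) (hn : 1 ≤ n) (hnq : n ≤ q) :
    (q - 1) * ∑ i ∈ Finset.Icc 1 (min (q - 1) n), seqS q (n - i) = seqS q n := by
  obtain ⟨q, rfl⟩ := Nat.exists_eq_add_of_le' (show 1 ≤ q by omega)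
  have hgeom : ∀ m < q + 1, q * ∑ i ∈ Finset.range m, seqS (q + 1) (i + 1) + q =
      q * (q + 1) ^ m := by
    intro m hm
    induction m with
    | zero => simp
    | succ m ih =>
      have := ih (by omega)
      rw [Finset.sum_range_succ, seqS_of_lt (by omega) hm, Nat.add_sub_cancel,
        Nat.add_sub_cancel]
      rw [pow_succ]
      linear_combination this
  have hreflect : ∀ k m, ∑ i ∈ Finset.Icc 1 k, seqS (q + 1) (m + k - i) =
      ∑ j ∈ Finset.range k, seqS (q + 1) (m + j) := by
    intro k m
    rw [← Finset.sum_range_reflect, ← Finset.Ico_add_one_right_eq_Icc,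
      Finset.sum_Ico_eq_sum_range, Nat.add_sub_cancel]
    refine Finset.sum_congr rfl fun j hj => congrArg _ ?_
    have := Finset.mem_range.mp hj
    omega
  rw [Nat.add_sub_cancel]
  rcases hnq.lt_or_eq with hlt | rfl
  · obtain ⟨m, rfl⟩ := Nat.exists_eq_add_of_le' hn
    have h := hreflect (m + 1) 0
    simp only [zero_add] at h
    rw [min_eq_right (by omega), seqS_of_lt hn hlt, h, Finset.sum_range_succ', mul_add,
      Nat.add_sub_cancel, Nat.add_sub_cancel, ← hgeom m (by omega)]
    simp [seqS]
  · have h := hreflect q 1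
    simp only [Nat.add_comm 1] at h
    rw [min_eq_left (by omega), seqS_self hn, h, Nat.add_sub_cancel, Nat.mul_sub, mul_one,
      ← hgeom q (by omega), Nat.add_sub_cancel]

variable {F : Type*} [Field F] [Fintype F]

/-- The number of good words of weight `n` is at most `seqS q n`: a good word starts with an index
`i < q`, or with an index that exceeds by `q` the first index of a good word of weight `n - q`. -/
theorem exists_finset_good (n : ℕ) :
    ∃ T : Finset (Word F), T.card ≤ seqS (Fintype.card F) n ∧
      ∀ w : Word F, Word.weight w = n → Word.Good w → w ∈ T := by
  classical
  induction n using Nat.strong_induction_on with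
  | _ n ih =>
    rcases Nat.eq_zero_or_pos n with rfl | hn
    · refine ⟨{[]}, by simp [seqS], fun w hw _ => ?_⟩
      cases w with
      | nil => simp
      | cons x w =>
        have := x.2.pos
        rw [Word.weight_cons] at hw
        omega
    choose! T hcard hT using ih
    set q := Fintype.card F with hq
    have hq2 : 2 ≤ q := Fintype.one_lt_card
    -- the words whose first index is less than `q`
    let A : Finset (Word F) := Finset.univ.biUnion fun ε : Fˣ =>
      (Finset.Icc 1 (min (q - 1) n)).biUnion fun i =>
        (T (n - i)).image (List.cons (ε, i.toPNat'))
    -- adding `q` to the first index yields the words whose first index exceeds `q`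
    let bump : Word F → Word F := fun w => match w with
      | [] => []
      | x :: w => (x.1, x.2 + qPos F) :: w
    have hA : A.card ≤ (q - 1) * ∑ i ∈ Finset.Icc 1 (min (q - 1) n), seqS q (n - i) := by
      calc A.card ≤ ∑ _ε : Fˣ, ∑ i ∈ Finset.Icc 1 (min (q - 1) n), seqS q (n - i) := by
            refine Finset.card_biUnion_le.trans (Finset.sum_le_sum fun ε _ => ?_)
            refine Finset.card_biUnion_le.trans (Finset.sum_le_sum fun i hi => ?_)
            have := (Finset.mem_Icc.mp hi).1
            exact Finset.card_image_le.trans (hcard _ (by omega))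
        _ = _ := by
            rw [Finset.sum_const, Finset.card_univ, Fintype.card_units, smul_eq_mul]
    have hmemA : ∀ (x : Letter F) (w : Word F), (x.2 : ℕ) < q → Word.weight (x :: w) = n →
        Word.Good (x :: w) → x :: w ∈ A := by
      intro x w hxq hw hg
      have hpos := x.2.pos
      rw [Word.weight_cons] at hw
      simp only [A, Finset.mem_biUnion, Finset.mem_univ, true_and, Finset.mem_image]
      refine ⟨x.1, x.2, Finset.mem_Icc.mpr ⟨hpos, by omega⟩, w,
        hT _ (by omega) w (by omega) (Word.good_cons.mp hg).2, ?_⟩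
      rw [PNat.coe_toPNat']
    have hlt : ∀ (x : Letter F) (w : Word F), Word.weight (x :: w) = n → Word.Good (x :: w) →
        n ≤ q → (x.2 : ℕ) < q := by
      intro x w hw hg hnq
      rw [Word.weight_cons] at hw
      refine lt_of_le_of_ne (by omega) fun h => (Word.good_cons.mp hg).1 (by rw [h])
    rcases le_or_gt n q with hnq | hnq
    · refine ⟨A, hA.trans (seqS_recursion_of_le hq2 hn hnq).le, fun w hw hg => ?_⟩
      cases w with
      | nil => simp at hw; omega
      | cons x w => exact hmemA x w (hlt x w hw hg hnq) hw hg
    · refine ⟨A ∪ (T (n - q)).image bump, ?_, fun w hw hg => ?_⟩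
      · rw [seqS_of_gt (by omega) hnq]
        rw [min_eq_left (by omega)] at hA
        exact (Finset.card_union_le _ _).trans
          (add_le_add hA (Finset.card_image_le.trans (hcard _ (by omega))))
      · cases w with
        | nil => simp at hw; omega
        | cons x w =>
          rcases lt_or_ge (x.2 : ℕ) q with hxq | hxq
          · exact Finset.mem_union_left _ (hmemA x w hxq hw hg)
          · obtain ⟨hx, hg'⟩ := Word.good_cons.mp hg
            have hne : (x.2 : ℕ) ≠ q := fun h => hx (by rw [h])
            have hpos : 0 < (x.2 : ℕ) - q := by omega
            rw [Word.weight_cons] at hw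
            refine Finset.mem_union_right _ (Finset.mem_image.mpr
              ⟨(x.1, ⟨(x.2 : ℕ) - q, hpos⟩) :: w, hT _ (by omega) _ ?_ ?_, ?_⟩)
            · rw [Word.weight_cons, PNat.mk_coe]
              omega
            · rw [Word.good_cons]
              refine ⟨fun h => hx ?_, hg'⟩
              have := (Nat.dvd_add_left (dvd_refl q)).mpr h
              rwa [PNat.mk_coe, Nat.sub_add_cancel hxq] at this
            · refine congrArg (· :: w) (Prod.ext rfl (PNat.eq ?_))
              exact Nat.sub_add_cancel hxq

theorem rank_AL_le [DecidableEq (RatFunc F)] (n : ℕ) :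
    Module.rank (RatFunc F) (AL F n) ≤ (seqS (Fintype.card F) n : Cardinal) := by
  classical
  obtain ⟨T, hcard, hT⟩ := exists_finset_good (F := F) n
  have hsub : AS F n ⊆ (T.image wordLi : Finset _) := by
    rw [AS_eq_image_wordLi]
    rintro _ ⟨w, ⟨h1, h2⟩, rfl⟩
    exact Finset.mem_coe.mpr (Finset.mem_image_of_mem _ (hT w h1 h2))
  rw [← span_AS_eq_AL]
  calc Module.rank (RatFunc F) (Submodule.span (RatFunc F) (AS F n))
      ≤ Cardinal.mk (AS F n) := rank_span_le _
    _ ≤ Cardinal.mk (T.image wordLi : Finset _) := Cardinal.mk_le_mk_of_subset hsub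
    _ ≤ _ := by
      rw [Cardinal.mk_coe_finset, Nat.cast_le]
      exact Finset.card_image_le.trans hcard

end counting

end ACMPL

end

theorem mainTheorem5 {F : Type*} [Field F] [Fintype F] [DecidableEq (RatFunc F)]
    (w : ℕ) (hw : 1 ≤ w) :
    Submodule.span (RatFunc F) (ACMPL.AS F w) = ACMPL.AL F w ∧
      Module.rank (RatFunc F) (ACMPL.AL F w) ≤ (ACMPL.seqS (Fintype.card F) w : Cardinal) :=
  ⟨ACMPL.span_AS_eq_AL w, ACMPL.rank_AL_le w⟩
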